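/- **Definitions.** Let $d\in\mathbb N$. A *generator* on $\mathbb R^d$ is a random vector $Z=(Z_1,\dots,Z_d)$ with $Z_i\ge 0$ almost surely and $E(Z_i)=1$ for $1\le i\le d$. A function $\|\cdot\|_D:\mathbb R^d\to\mathbb R$ is called a *$D$-norm* if there is a generator $Z$, with components almost surely bounded by a constant, such that $$\|x\|_D=E\Big(\max_{1\le i\le d}|x_i|Z_i\Big),\qquad x\in\mathbb R^d .$$ (Dropping the boundedness of $Z$ yields the same class of functions.) For $D$-norms $\|\cdot\|_{D^{(1)}},\|\cdot\|_{D^{(2)}}$ on $\mathbb R^d$, the product $\|\cdot\|_{D^{(1)}D^{(2)}}$ is the $D$-norm generated by the componentwise product $Z^{(1)}Z^{(2)}$ of independent generators $Z^{(1)},Z^{(2)}$ of the two $D$-norms; it does not depend on the choice of these generators. For a sequence $\|\cdot\|_{D^{(n)}}$, $n=1,2,\dots$, of $D$-norms on $\mathbb R^d$, its *track* is the sequence of $D$-norms defined recursively by $$\|\cdot\|_{\prod_{i=1}^{1}D^{(i)}}:=\|\cdot\|_{D^{(1)}},\qquad \|\cdot\|_{\prod_{i=1}^{n+1}D^{(i)}}:=\|\cdot\|_{D^{(n+1)}\prod_{i=1}^{n}D^{(i)}}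 .$$ **Proposition.** Let $\|\cdot\|_{D^{(n)}}$, $n=1,2,\dots$, be arbitrary $D$-norms on $\mathbb R^d$. Then for every $x\in\mathbb R^d$ the sequence $\|x\|_{\prod_{i=1}^nD^{(i)}}$, $n=1,2,\dots$, is non-decreasing and bounded from above by $\|x\|_1=\sum_{i=1}^d|x_i|$. Moreover, the limit $$f(x):=\lim_{n\to\infty}\|x\|_{\prod_{i=1}^nD^{(i)}}$$ exists in $\mathbb R$ for every $x\in\mathbb R^d$, and the function $f$ is a $D$-norm on $\mathbb R^d$. -/

import Mathlib

open MeasureTheory ProbabilityTheory Filter Topology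

noncomputable section

namespace DNormTrack

/-- A generator on `ℝ^d`: a random vector `Z = (Z_1, …, Z_d)` with `Z_i ≥ 0` a.s. and
`E (Z_i) = 1` (no boundedness is required). -/
structure IsGenerator {d : ℕ} {Ω : Type*} [MeasurableSpace Ω] (P : Measure Ω)
    (Z : Ω → Fin d → ℝ) : Prop where
  measurable : Measurable Z
  nonneg : ∀ i, ∀ᵐ ω ∂P, 0 ≤ Z ω i
  integrable : ∀ i, Integrable (fun ω => Z ω i) P
  mean_one : ∀ i, ∫ ω, Z ω i ∂P = 1

/-- The function `x ↦ E (max_i |x_i Z_i|)`. Here `x * Z ω` is the componentwise product, and the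
norm of `Fin d → ℝ` is the maximum norm. -/
def genNorm {d : ℕ} {Ω : Type*} [MeasurableSpace Ω] (P : Measure Ω)
    (Z : Ω → Fin d → ℝ) (x : Fin d → ℝ) : ℝ :=
  ∫ ω, ‖x * Z ω‖ ∂P

/-- `N` is a `D`-norm on `ℝ^d`: it is `x ↦ E (max_i (|x_i| Z_i))` for some a.s. bounded
generator `Z`. By `isDNorm_genNorm` the boundedness may equivalently be dropped. -/
def IsDNorm {d : ℕ} (N : (Fin d → ℝ) → ℝ) : Prop :=
  ∃ (Ω : Type) (_ : MeasurableSpace Ω) (P : Measure Ω) (Z : Ω → Fin d → ℝ),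
    IsProbabilityMeasure P ∧ IsGenerator P Z ∧ (∃ c : ℝ, ∀ i, ∀ᵐ ω ∂P, Z ω i ≤ c) ∧
      ∀ x, N x = genNorm P Z x

theorem IsGenerator.integrable_norm {d : ℕ} {Ω : Type*} [MeasurableSpace Ω] {P : Measure Ω}
    {Z : Ω → Fin d → ℝ} (h : IsGenerator P Z) (x : Fin d → ℝ) :
    Integrable (fun ω => ‖x * Z ω‖) P := by
  have hZ : Integrable Z P := Integrable.of_eval h.integrable
  have hm := h.measurable
  refine (hZ.norm.const_mul ‖x‖).mono' ?_ (Eventually.of_forall fun ω => ?_)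
  · exact (hm.const_mul x).norm.aestronglyMeasurable
  · rw [norm_norm]
    exact norm_mul_le _ _

/-- Every generator, bounded or not and on any probability space, generates a `D`-norm. -/
theorem isDNorm_genNorm {d : ℕ} {Ω : Type*} [MeasurableSpace Ω] {P : Measure Ω}
    [IsProbabilityMeasure P] {Z : Ω → Fin d → ℝ} (h : IsGenerator P Z) :
    IsDNorm (genNorm P Z) := by
  have hm := h.measurable
  have hmi : ∀ i, Measurable fun ω => Z ω i := fun i => (measurable_pi_apply i).comp hm
  rcases Nat.eq_zero_or_pos d with rfl | hd
  · refine ⟨Unit, inferInstance, Measure.dirac (), fun _ i => i.elim0, inferInstance,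
      ⟨measurable_const, fun i => i.elim0, fun i => i.elim0, fun i => i.elim0⟩,
      ⟨0, fun i => i.elim0⟩, fun x => ?_⟩
    have e : ∀ y : Fin 0 → ℝ, ‖y‖ = 0 := fun y => by
      rw [Subsingleton.elim y 0, norm_zero]
    simp [genNorm, e]
  have hd' : (0 : ℝ) < d := by exact_mod_cast hd
  set S : Ω → ℝ := fun ω => ∑ i, |Z ω i| with hS
  have hSm : Measurable S := Finset.measurable_sum _ fun i _ => (hmi i).abs
  have hS0 : ∀ ω, 0 ≤ S ω := fun ω => Finset.sum_nonneg fun i _ => abs_nonneg _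
  have hle : ∀ ω i, |Z ω i| ≤ S ω := fun ω i =>
    Finset.single_le_sum (f := fun j => |Z ω j|) (fun j _ => abs_nonneg _) (Finset.mem_univ i)
  have habs : ∀ i, ∫ ω, |Z ω i| ∂P = 1 := fun i => by
    rw [← h.mean_one i]
    exact integral_congr_ae ((h.nonneg i).mono fun ω hω => abs_of_nonneg hω)
  have hSint : ∫ ω, S ω / d ∂P = 1 := by
    rw [integral_div, hS, integral_finsetSum _ fun i _ => (h.integrable i).abs]
    simp only [habs]
    simp [hd'.ne']
  have hSi : Integrable (fun ω => S ω / d) P :=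
    (integrable_finsetSum _ fun i _ => (h.integrable i).abs).div_const _
  set Q : Measure Ω := P.withDensity fun ω => ENNReal.ofReal (S ω / d) with hQ
  have hQp : IsProbabilityMeasure Q := by
    constructor
    rw [hQ, withDensity_apply _ MeasurableSet.univ, Measure.restrict_univ,
      ← ofReal_integral_eq_lintegral_ofReal hSi
        (Eventually.of_forall fun ω => div_nonneg (hS0 ω) hd'.le), hSint, ENNReal.ofReal_one]
  set W : Ω → Fin d → ℝ := fun ω i => d * |Z ω i| / S ω with hW
  have hWm : Measurable W := measurable_pi_lambda _ fun i => ((hmi i).abs.const_mul _).div hSm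
  have hW0 : ∀ ω i, 0 ≤ W ω i := fun ω i =>
    div_nonneg (mul_nonneg hd'.le (abs_nonneg _)) (hS0 ω)
  have hWd : ∀ ω i, W ω i ≤ d := fun ω i => by
    have := hle ω i
    exact div_le_of_le_mul₀ (hS0 ω) hd'.le (by gcongr)
  have hSW : ∀ ω i, S ω / d * W ω i = |Z ω i| := fun ω i => by
    simp only [hW]
    rcases (hS0 ω).eq_or_lt with h0 | h0
    · have := hle ω i
      have h2 := abs_nonneg (Z ω i)
      rw [← h0] at this ⊢
      simp only [zero_div, zero_mul]
      linarith
    · field_simp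
  have hint : ∀ g : Ω → ℝ, ∫ ω, g ω ∂Q = ∫ ω, S ω / d * g ω ∂P := fun g => by
    rw [hQ, integral_withDensity_eq_integral_toReal_smul (by fun_prop)
      (Eventually.of_forall fun _ => ENNReal.ofReal_lt_top)]
    refine integral_congr_ae (Eventually.of_forall fun ω => ?_)
    simp [ENNReal.toReal_ofReal (div_nonneg (hS0 ω) hd'.le)]
  have hWim : ∀ i, Measurable fun ω => W ω i := fun i => (measurable_pi_apply i).comp hWm
  refine ⟨Fin d → ℝ, MeasurableSpace.pi, Q.map W, id,
    Measure.isProbabilityMeasure_map hWm.aemeasurable, ⟨measurable_id, fun i => ?_, fun i => ?_,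
    fun i => ?_⟩, ⟨d, fun i => ?_⟩, fun x => ?_⟩
  · simp only [id]
    rw [ae_map_iff hWm.aemeasurable (measurableSet_le measurable_const (measurable_pi_apply i))]
    exact Eventually.of_forall fun ω => hW0 ω i
  · simp only [id]
    rw [integrable_map_measure (measurable_pi_apply i).aestronglyMeasurable hWm.aemeasurable]
    refine Integrable.of_bound (hWim i).aestronglyMeasurable d (Eventually.of_forall fun ω => ?_)
    simpa [abs_of_nonneg (hW0 ω i)] using hWd ω i
  · have e := integral_map (μ := Q) hWm.aemeasurable
      (f := fun z : Fin d → ℝ => z i) (measurable_pi_apply i).aestronglyMeasurable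
    simp only [id]
    rw [e, hint]
    simp only [hSW, habs]
  · simp only [id]
    rw [ae_map_iff hWm.aemeasurable (measurableSet_le (measurable_pi_apply i) measurable_const)]
    exact Eventually.of_forall fun ω => hWd ω i
  · have hxm : Measurable fun z : Fin d → ℝ => ‖x * z‖ := by fun_prop
    have e := integral_map (μ := Q) hWm.aemeasurable
      (f := fun z : Fin d → ℝ => ‖x * z‖) hxm.aestronglyMeasurable
    simp only [genNorm, id]
    rw [e, hint]
    refine integral_congr_ae (Eventually.of_forall fun ω => ?_)
    have hp : 0 ≤ S ω / d := div_nonneg (hS0 ω) hd'.le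
    have e1 : S ω / d * ‖x * W ω‖ = ‖(S ω / d) • (x * W ω)‖ := by
      rw [norm_smul, Real.norm_of_nonneg hp]
    have e2 : (S ω / d) • (x * W ω) = x * fun i => |Z ω i| := by
      funext i
      simp only [Pi.smul_apply, Pi.mul_apply, smul_eq_mul, ← hSW ω i]
      ring
    simp only
    rw [e1, e2]
    simp [Pi.norm_def]

/-- The `D`-norms on `ℝ^d`. -/
structure DNorm (d : ℕ) where
  toFun : (Fin d → ℝ) → ℝ
  isDNorm : IsDNorm toFun

instance {d : ℕ} : CoeFun (DNorm d) (fun _ => (Fin d → ℝ) → ℝ) := ⟨DNorm.toFun⟩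

/-- `Z` generates the `D`-norm `D`. -/
def DNorm.GeneratedBy {d : ℕ} (D : DNorm d) {Ω : Type*} [MeasurableSpace Ω] (P : Measure Ω)
    (Z : Ω → Fin d → ℝ) : Prop :=
  IsGenerator P Z ∧ ∀ x, D x = genNorm P Z x

theorem DNorm.exists_law {d : ℕ} (D : DNorm d) :
    ∃ μ : Measure (Fin d → ℝ), IsProbabilityMeasure μ ∧ D.GeneratedBy μ id := by
  obtain ⟨Ω, _, P, Z, hP, hZ, -, hN⟩ := D.isDNorm
  have hm := hZ.measurable
  refine ⟨P.map Z, Measure.isProbabilityMeasure_map hm.aemeasurable,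
    ⟨measurable_id, fun i => ?_, fun i => ?_, fun i => ?_⟩, fun x => ?_⟩
  · simp only [id]
    rw [ae_map_iff hm.aemeasurable (measurableSet_le measurable_const (measurable_pi_apply i))]
    exact hZ.nonneg i
  · simp only [id]
    rw [integrable_map_measure (measurable_pi_apply i).aestronglyMeasurable hm.aemeasurable]
    exact hZ.integrable i
  · have e := integral_map (μ := P) hm.aemeasurable
      (f := fun z : Fin d → ℝ => z i) (measurable_pi_apply i).aestronglyMeasurable
    simp only [id]
    rw [e, hZ.mean_one]
  · have hxm : Measurable fun z : Fin d → ℝ => ‖x * z‖ := by fun_prop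
    have e := integral_map (μ := P) hm.aemeasurable
      (f := fun z : Fin d → ℝ => ‖x * z‖) hxm.aestronglyMeasurable
    rw [hN]
    simp only [genNorm, id]
    rw [e]

/-- The law of some generator of the `D`-norm `D`. -/
def DNorm.law {d : ℕ} (D : DNorm d) : Measure (Fin d → ℝ) := D.exists_law.choose

instance {d : ℕ} (D : DNorm d) : IsProbabilityMeasure D.law := D.exists_law.choose_spec.1

theorem DNorm.generatedBy_law {d : ℕ} (D : DNorm d) : D.GeneratedBy D.law id :=
  D.exists_law.choose_spec.2

/-- The componentwise product of two independent generators is a generator. -/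
theorem IsGenerator.mul {d : ℕ} {Ω : Type*} [MeasurableSpace Ω] {P : Measure Ω}
    {Z₁ Z₂ : Ω → Fin d → ℝ} (h₁ : IsGenerator P Z₁) (h₂ : IsGenerator P Z₂)
    (hind : IndepFun Z₁ Z₂ P) : IsGenerator P (Z₁ * Z₂) := by
  have hi : ∀ i, IndepFun (fun ω => Z₁ ω i) (fun ω => Z₂ ω i) P := fun i =>
    hind.comp (measurable_pi_apply i) (measurable_pi_apply i)
  refine ⟨h₁.measurable.mul h₂.measurable, fun i => ?_, fun i => ?_, fun i => ?_⟩
  · filter_upwards [h₁.nonneg i, h₂.nonneg i] with ω a b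
    exact mul_nonneg a b
  · exact (hi i).integrable_mul (h₁.integrable i) (h₂.integrable i)
  · have := (hi i).integral_fun_mul_eq_mul_integral (h₁.integrable i).aestronglyMeasurable
      (h₂.integrable i).aestronglyMeasurable
    simpa [h₁.mean_one, h₂.mean_one] using this

theorem isGenerator_prod {d : ℕ} (D₁ D₂ : DNorm d) :
    IsGenerator (D₁.law.prod D₂.law)
      ((Prod.fst : (Fin d → ℝ) × (Fin d → ℝ) → Fin d → ℝ) * Prod.snd) := by
  have h₁ := D₁.generatedBy_law.1
  have h₂ := D₂.generatedBy_law.1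
  refine IsGenerator.mul ⟨measurable_fst, fun i => ?_, fun i => ?_, fun i => ?_⟩
    ⟨measurable_snd, fun i => ?_, fun i => ?_, fun i => ?_⟩
    (indepFun_prod (X := id) (Y := id) measurable_id measurable_id)
  · exact Measure.quasiMeasurePreserving_fst.ae (h₁.nonneg i)
  · exact (h₁.integrable i).comp_fst D₂.law
  · have := integral_fun_fst (μ := D₁.law) (ν := D₂.law) (fun z : Fin d → ℝ => z i)
    simpa using this.trans (by simpa using h₁.mean_one i)
  · exact Measure.quasiMeasurePreserving_snd.ae (h₂.nonneg i)
  · exact (h₂.integrable i).comp_snd D₁.law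
  · have := integral_fun_snd (μ := D₁.law) (ν := D₂.law) (fun z : Fin d → ℝ => z i)
    simpa using this.trans (by simpa using h₂.mean_one i)

/-- The product of two `D`-norms: the `D`-norm generated by `Z⁽¹⁾ Z⁽²⁾` (componentwise product),
where `Z⁽¹⁾`, `Z⁽²⁾` are independent generators of the two factors. By `DNorm.mul_apply` below it
does not depend on the choice of these generators. -/
instance {d : ℕ} : Mul (DNorm d) where
  mul D₁ D₂ :=
    { toFun := genNorm (D₁.law.prod D₂.law)
        ((Prod.fst : (Fin d → ℝ) × (Fin d → ℝ) → Fin d → ℝ) * Prod.snd)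
      isDNorm := isDNorm_genNorm (isGenerator_prod D₁ D₂) }

/-- The product can be computed from any independent generators on any probability space. -/
theorem DNorm.mul_apply {d : ℕ} (D₁ D₂ : DNorm d) {Ω : Type*} [MeasurableSpace Ω]
    {P : Measure Ω} [IsProbabilityMeasure P] {Z₁ Z₂ : Ω → Fin d → ℝ}
    (h₁ : D₁.GeneratedBy P Z₁) (h₂ : D₂.GeneratedBy P Z₂) (hind : IndepFun Z₁ Z₂ P)
    (x : Fin d → ℝ) : (D₁ * D₂) x = genNorm P (Z₁ * Z₂) x := by
  have m₁ := h₁.1.measurable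
  have m₂ := h₂.1.measurable
  have hfm : Measurable fun p : (Fin d → ℝ) × (Fin d → ℝ) => ‖x * (p.1 * p.2)‖ := by fun_prop
  have p₁ : IsProbabilityMeasure (P.map Z₁) := Measure.isProbabilityMeasure_map m₁.aemeasurable
  have p₂ : IsProbabilityMeasure (P.map Z₂) := Measure.isProbabilityMeasure_map m₂.aemeasurable
  have hlaw := (indepFun_iff_map_prod_eq_prod_map_map m₁.aemeasurable m₂.aemeasurable).1 hind
  have e := integral_map (μ := P) (m₁.prodMk m₂).aemeasurable hfm.aestronglyMeasurable
  have i1 : Integrable (fun p : (Fin d → ℝ) × (Fin d → ℝ) => ‖x * (p.1 * p.2)‖)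
      ((P.map Z₁).prod (P.map Z₂)) := by
    rw [← hlaw, integrable_map_measure hfm.aestronglyMeasurable (m₁.prodMk m₂).aemeasurable]
    exact (h₁.1.mul h₂.1 hind).integrable_norm x
  have i2 : Integrable (fun p : (Fin d → ℝ) × (Fin d → ℝ) => ‖x * (p.1 * p.2)‖)
      (D₁.law.prod D₂.law) := (isGenerator_prod D₁ D₂).integrable_norm x
  have k₁ : ∀ y, ∫ z, ‖y * z‖ ∂(P.map Z₁) = D₁ y := fun y => by
    rw [h₁.2, genNorm, integral_map m₁.aemeasurable
      (by fun_prop : Measurable fun z : Fin d → ℝ => ‖y * z‖).aestronglyMeasurable]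
  have k₂ : ∀ y, ∫ z, ‖y * z‖ ∂(P.map Z₂) = D₂ y := fun y => by
    rw [h₂.2, genNorm, integral_map m₂.aemeasurable
      (by fun_prop : Measurable fun z : Fin d → ℝ => ‖y * z‖).aestronglyMeasurable]
  have l₁ : ∀ y, ∫ z, ‖y * z‖ ∂D₁.law = D₁ y := fun y => (D₁.generatedBy_law.2 y).symm
  have l₂ : ∀ y, ∫ z, ‖y * z‖ ∂D₂.law = D₂ y := fun y => (D₂.generatedBy_law.2 y).symm
  have i3 : Integrable (fun p : (Fin d → ℝ) × (Fin d → ℝ) => ‖x * (p.1 * p.2)‖)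
      ((P.map Z₁).prod D₂.law) := by
    rw [integrable_prod_iff hfm.aestronglyMeasurable] at i1 ⊢
    refine ⟨Eventually.of_forall fun z => ?_, ?_⟩
    · simp only [← mul_assoc]
      exact D₂.generatedBy_law.1.integrable_norm (x * z)
    · have := i1.2
      simp only [norm_norm, ← mul_assoc, k₂, l₂] at this ⊢
      exact this
  calc (D₁ * D₂) x = ∫ p, ‖x * (p.1 * p.2)‖ ∂(D₁.law.prod D₂.law) := rfl
    _ = ∫ w, D₁ (x * w) ∂D₂.law := by
        rw [integral_prod_symm _ i2]
        congr 1; funext w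
        rw [← l₁]
        congr 1; funext z; congr 1; ring
    _ = ∫ p, ‖x * (p.1 * p.2)‖ ∂((P.map Z₁).prod D₂.law) := by
        rw [integral_prod_symm _ i3]
        congr 1; funext w
        rw [← k₁]
        congr 1; funext z; congr 1; ring
    _ = ∫ z, D₂ (x * z) ∂(P.map Z₁) := by
        rw [integral_prod _ i3]
        simp only [← mul_assoc, l₂]
    _ = ∫ p, ‖x * (p.1 * p.2)‖ ∂((P.map Z₁).prod (P.map Z₂)) := by
        rw [integral_prod _ i1]
        simp only [← mul_assoc, k₂]
    _ = genNorm P (Z₁ * Z₂) x := by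
        rw [← hlaw, e]
        rfl

/-- The track of `D 0, D 1, …`: `track D n` is the product of `D 0, …, D n`, built recursively. -/
def track {d : ℕ} (D : ℕ → DNorm d) : ℕ → DNorm d
  | 0 => D 0
  | n + 1 => D (n + 1) * track D n

end DNormTrack

end

/-!
Since the components of a generator `Z` have mean one, Jensen's inequality gives
`‖y‖_∞ = ‖E (y Z)‖_∞ ≤ E ‖y Z‖_∞ = ‖y‖_D` (`norm_le_genNorm`), while bounding the maximum by the
sum gives `‖y‖_D ≤ ‖y‖_1` (`genNorm_le_sum_abs`). Conditioning on the second factor of a product,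
`‖x‖_{D₁D₂} = E ‖x Z⁽²⁾‖_{D₁}`, so the first inequality yields `‖x‖_{D₂} ≤ ‖x‖_{D₁D₂}`: the track is
monotone, bounded by `‖·‖_1`, and hence convergent.

That the limit is a `D`-norm is a compactness statement. The almost sure limit of the
product generators is of no use, because it may lose mass (it can be zero). Instead, each
`D`-norm on `ℝ^d` is generated by a random vector in the cube `[0, d]^d`: reweight the probability
by `(Z_1 + ⋯ + Z_d) / d` and rescale `Z` to have component sum `d`
(`IsDNorm.exists_probabilityMeasure_cube`). The probability measures on the cube with mean vector
`(1, …, 1)` form a weakly compact set, and `μ ↦ (x ↦ ∫ ‖x z‖ dμ(z))` is continuous for pointwise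
convergence, so its image, the set of all `D`-norms, is compact (`isCompact_setOf_isDNorm`). In
particular it is closed under pointwise limits.
-/

namespace DNormTrack

/-! ### Bounds for a single `D`-norm -/

/-- Every `D`-norm dominates the maximum norm. -/
theorem norm_le_genNorm {d : ℕ} {Ω : Type*} [MeasurableSpace Ω] {P : Measure Ω}
    {Z : Ω → Fin d → ℝ} (h : IsGenerator P Z) (x : Fin d → ℝ) : ‖x‖ ≤ genNorm P Z x := by
  refine (pi_norm_le_iff_of_nonneg (integral_nonneg fun ω => norm_nonneg _)).2 fun i => ?_
  have e : ∫ ω, x i * Z ω i ∂P = x i := by rw [integral_const_mul, h.mean_one, mul_one]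
  calc ‖x i‖ = ‖∫ ω, x i * Z ω i ∂P‖ := by rw [e]
    _ ≤ ∫ ω, ‖x i * Z ω i‖ ∂P := norm_integral_le_integral_norm _
    _ ≤ genNorm P Z x :=
        integral_mono ((h.integrable i).const_mul _).norm (h.integrable_norm x)
          fun ω => norm_le_pi_norm (x * Z ω) i

theorem genNorm_le_sum_abs {d : ℕ} {Ω : Type*} [MeasurableSpace Ω] {P : Measure Ω}
    {Z : Ω → Fin d → ℝ} (h : IsGenerator P Z) (x : Fin d → ℝ) :
    genNorm P Z x ≤ ∑ i, |x i| := by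
  have habs : ∀ i, ∫ ω, |x i * Z ω i| ∂P = |x i| := fun i => by
    rw [← mul_one |x i|, ← h.mean_one i, ← integral_const_mul]
    refine integral_congr_ae ((h.nonneg i).mono fun ω hω => ?_)
    simp only [abs_mul, abs_of_nonneg hω]
  have hint : ∀ i, Integrable (fun ω => |x i * Z ω i|) P := fun i =>
    ((h.integrable i).const_mul _).abs
  calc genNorm P Z x ≤ ∫ ω, ∑ i, |x i * Z ω i| ∂P :=
        integral_mono (h.integrable_norm x) (integrable_finsetSum _ fun i _ => hint i) fun ω =>
          (pi_norm_le_iff_of_nonneg (Finset.sum_nonneg fun i _ => abs_nonneg _)).2 fun i =>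
            Finset.single_le_sum (f := fun j => |x j * Z ω j|) (fun j _ => abs_nonneg _)
              (Finset.mem_univ i)
    _ = ∑ i, |x i| := by
        rw [integral_finsetSum _ fun i _ => hint i]
        exact Finset.sum_congr rfl fun i _ => habs i

theorem DNorm.norm_le {d : ℕ} (D : DNorm d) (x : Fin d → ℝ) : ‖x‖ ≤ D x := by
  rw [D.generatedBy_law.2]
  exact norm_le_genNorm D.generatedBy_law.1 x

theorem DNorm.le_sum_abs {d : ℕ} (D : DNorm d) (x : Fin d → ℝ) : D x ≤ ∑ i, |x i| := by
  rw [D.generatedBy_law.2]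
  exact genNorm_le_sum_abs D.generatedBy_law.1 x

/-! ### Monotonicity of products -/

theorem DNorm.le_mul_left {d : ℕ} (D₁ D₂ : DNorm d) (x : Fin d → ℝ) : D₂ x ≤ (D₁ * D₂) x := by
  have hi : Integrable (fun p : (Fin d → ℝ) × (Fin d → ℝ) => ‖x * (p.1 * p.2)‖)
      (D₁.law.prod D₂.law) := (isGenerator_prod D₁ D₂).integrable_norm x
  have hD : ∀ w, ∫ z, ‖x * (z * w)‖ ∂D₁.law = D₁ (x * w) := fun w => by
    rw [D₁.generatedBy_law.2, genNorm]
    refine integral_congr_ae (Eventually.of_forall fun z => ?_)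
    simp only [id, mul_comm z w, mul_assoc]
  have hi₂ : Integrable (fun w => D₁ (x * w)) D₂.law := by
    simpa only [hD] using hi.integral_prod_right
  calc D₂ x = ∫ w, ‖x * w‖ ∂D₂.law := D₂.generatedBy_law.2 x
    _ ≤ ∫ w, D₁ (x * w) ∂D₂.law :=
        integral_mono (D₂.generatedBy_law.1.integrable_norm x) hi₂ fun w => D₁.norm_le (x * w)
    _ = ∫ p, ‖x * (p.1 * p.2)‖ ∂(D₁.law.prod D₂.law) := by
        rw [integral_prod_symm _ hi]
        simp only [hD]
    _ = (D₁ * D₂) x := rfl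

theorem monotone_track {d : ℕ} (D : ℕ → DNorm d) (x : Fin d → ℝ) :
    Monotone fun n : ℕ => track D n x :=
  monotone_nat_of_le_succ fun n => (D (n + 1)).le_mul_left (track D n) x

/-! ### Compactness of the set of `D`-norms -/

/-- The cube `[0, d]^d`. -/
abbrev cube (d : ℕ) : Set (Fin d → ℝ) := Set.Icc 0 fun _ => (d : ℝ)

/-- Every `D`-norm has a generator with values in the cube `[0, d]^d`, a bound which depends on
the dimension only. It arises from an arbitrary generator `Z` with component sum `S` by passing to
the probability with density `S / d` and replacing `Z` by `d Z / S`: the map `z ↦ ‖x * z‖` being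
positively homogeneous, the expectation does not change. -/
theorem IsDNorm.exists_probabilityMeasure_cube {d : ℕ} {N : (Fin d → ℝ) → ℝ} (h : IsDNorm N) :
    ∃ μ : ProbabilityMeasure (cube d), (∀ i, ∫ z, (z : Fin d → ℝ) i ∂(μ : Measure (cube d)) = 1) ∧
      ∀ x, ∫ z, ‖x * (z : Fin d → ℝ)‖ ∂(μ : Measure (cube d)) = N x := by
  obtain ⟨Ω, _, P, Z, hP, hZ, -, hN⟩ := h
  rcases Nat.eq_zero_or_pos d with rfl | hd
  -- In dimension zero the density `S / d` would vanish, but any measure will do.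
  · have e : ∀ y : Fin 0 → ℝ, ‖y‖ = 0 := fun y => by rw [Subsingleton.elim y 0, norm_zero]
    exact ⟨⟨Measure.dirac ⟨0, by simp⟩, inferInstance⟩, fun i => i.elim0,
      fun x => by simp [hN, genNorm, e]⟩
  have hd' : (0 : ℝ) < d := by exact_mod_cast hd
  have hmi : ∀ i, Measurable fun ω => Z ω i := fun i =>
    (measurable_pi_apply i).comp hZ.measurable
  set S : Ω → ℝ := fun ω => ∑ i, |Z ω i| with hS
  have hSm : Measurable S := Finset.measurable_sum _ fun i _ => (hmi i).abs
  have hS0 : ∀ ω, 0 ≤ S ω := fun ω => Finset.sum_nonneg fun i _ => abs_nonneg _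
  have hSd : ∀ ω, 0 ≤ S ω / d := fun ω => div_nonneg (hS0 ω) hd'.le
  have hle : ∀ ω i, |Z ω i| ≤ S ω := fun ω i =>
    Finset.single_le_sum (f := fun j => |Z ω j|) (fun j _ => abs_nonneg _) (Finset.mem_univ i)
  have habs : ∀ i, ∫ ω, |Z ω i| ∂P = 1 := fun i => by
    rw [← hZ.mean_one i]
    exact integral_congr_ae ((hZ.nonneg i).mono fun ω hω => abs_of_nonneg hω)
  have hSint : ∫ ω, S ω / d ∂P = 1 := by
    rw [integral_div, hS, integral_finsetSum _ fun i _ => (hZ.integrable i).abs]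
    simp [habs, hd'.ne']
  have hSi : Integrable (fun ω => S ω / d) P :=
    (integrable_finsetSum _ fun i _ => (hZ.integrable i).abs).div_const _
  set Q : Measure Ω := P.withDensity fun ω => ENNReal.ofReal (S ω / d) with hQ
  have hQp : IsProbabilityMeasure Q := by
    constructor
    rw [hQ, withDensity_apply _ MeasurableSet.univ, Measure.restrict_univ,
      ← ofReal_integral_eq_lintegral_ofReal hSi (Eventually.of_forall hSd), hSint,
      ENNReal.ofReal_one]
  have hint : ∀ g : Ω → ℝ, ∫ ω, g ω ∂Q = ∫ ω, S ω / d * g ω ∂P := fun g => by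
    rw [hQ, integral_withDensity_eq_integral_toReal_smul (by fun_prop)
      (Eventually.of_forall fun _ => ENNReal.ofReal_lt_top)]
    simp only [ENNReal.toReal_ofReal (hSd _), smul_eq_mul]
  -- Where `S` vanishes, so does `Z`, and division by zero makes the rescaled vector zero as well.
  let W : Ω → cube d := fun ω => ⟨fun i => d * |Z ω i| / S ω,
    fun i => div_nonneg (mul_nonneg hd'.le (abs_nonneg _)) (hS0 ω),
    fun i => div_le_of_le_mul₀ (hS0 ω) hd'.le (mul_le_mul_of_nonneg_left (hle ω i) hd'.le)⟩
  have hWm : Measurable W :=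
    (measurable_pi_lambda _ fun i => ((hmi i).abs.const_mul _).div hSm).subtype_mk
  have hSW : ∀ ω i, S ω / d * (W ω : Fin d → ℝ) i = |Z ω i| := fun ω i => by
    rcases (hS0 ω).eq_or_lt with h0 | h0
    · have h1 : |Z ω i| = 0 := le_antisymm (h0 ▸ hle ω i) (abs_nonneg _)
      rw [h1, ← h0, zero_div, zero_mul]
    · simp only [W]
      field_simp
  have hmap : ∀ g : cube d → ℝ, Continuous g →
      ∫ z, g z ∂Q.map W = ∫ ω, S ω / d * g (W ω) ∂P := fun g hg => by
    rw [integral_map hWm.aemeasurable hg.aestronglyMeasurable, hint]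
  refine ⟨⟨Q.map W, Measure.isProbabilityMeasure_map hWm.aemeasurable⟩, fun i => ?_, fun x => ?_⟩
  · rw [ProbabilityMeasure.coe_mk, hmap (fun z => (z : Fin d → ℝ) i)
      ((continuous_apply i).comp continuous_subtype_val)]
    simp only [hSW, habs]
  · rw [ProbabilityMeasure.coe_mk, hmap (fun z => ‖x * (z : Fin d → ℝ)‖) (by fun_prop), hN,
      genNorm]
    congr 1
    funext ω
    have e : (S ω / d) • (x * (W ω : Fin d → ℝ)) = x * fun i => |Z ω i| := by
      funext i
      simp only [Pi.smul_apply, Pi.mul_apply, smul_eq_mul, ← hSW ω i]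
      ring
    rw [← Real.norm_of_nonneg (hSd ω), ← norm_smul, e]
    simp [Pi.norm_def]

theorem isDNorm_integral_cube {d : ℕ} (μ : ProbabilityMeasure (cube d))
    (h : ∀ i, ∫ z, (z : Fin d → ℝ) i ∂(μ : Measure (cube d)) = 1) :
    IsDNorm fun x => ∫ z, ‖x * (z : Fin d → ℝ)‖ ∂(μ : Measure (cube d)) :=
  isDNorm_genNorm (P := (μ : Measure (cube d))) (Z := Subtype.val)
    ⟨measurable_subtype_coe, fun i => Eventually.of_forall fun z => z.2.1 i,
      -- a non-integrable function would have integral zero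
      fun i => Integrable.of_integral_ne_zero (by rw [h i]; exact one_ne_zero), h⟩

theorem continuous_integral_cube {d : ℕ} {g : cube d → ℝ} (hg : Continuous g) :
    Continuous fun μ : ProbabilityMeasure (cube d) => ∫ z, g z ∂(μ : Measure (cube d)) :=
  ProbabilityMeasure.continuous_integral_boundedContinuousFunction
    (BoundedContinuousFunction.mkOfCompact ⟨g, hg⟩)

/-- The set of `D`-norms on `ℝ^d` is compact for the topology of pointwise convergence. -/
theorem isCompact_setOf_isDNorm (d : ℕ) : IsCompact {N : (Fin d → ℝ) → ℝ | IsDNorm N} := by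
  set M : Set (ProbabilityMeasure (cube d)) :=
    {μ | ∀ i, ∫ z, (z : Fin d → ℝ) i ∂(μ : Measure (cube d)) = 1} with hM
  have hMc : IsCompact M := by
    rw [hM, Set.ofPred_forall]
    exact (isClosed_iInter fun i =>
      isClosed_eq (continuous_integral_cube ((continuous_apply i).comp continuous_subtype_val))
        continuous_const).isCompact
  convert hMc.image (f := fun (μ : ProbabilityMeasure (cube d)) x =>
      ∫ z, ‖x * (z : Fin d → ℝ)‖ ∂(μ : Measure (cube d)))
    (continuous_pi fun x => continuous_integral_cube (by fun_prop)) using 1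
  ext N
  constructor
  · intro hN
    obtain ⟨μ, hμ, e⟩ := IsDNorm.exists_probabilityMeasure_cube hN
    exact ⟨μ, hμ, funext e⟩
  · rintro ⟨μ, hμ, rfl⟩
    exact isDNorm_integral_cube μ hμ

end DNormTrack

theorem mainTheorem5 (d : ℕ) (D : ℕ → DNormTrack.DNorm d) :
    (∀ x : Fin d → ℝ, Monotone fun n : ℕ => DNormTrack.track D n x) ∧
    (∀ (n : ℕ) (x : Fin d → ℝ), DNormTrack.track D n x ≤ ∑ i, |x i|) ∧
    ∃ f : (Fin d → ℝ) → ℝ,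
      (∀ x : Fin d → ℝ, Tendsto (fun n : ℕ => DNormTrack.track D n x) atTop (𝓝 (f x))) ∧
      DNormTrack.IsDNorm f := by
  have hmono := DNormTrack.monotone_track D
  have hle : ∀ (n : ℕ) (x : Fin d → ℝ), DNormTrack.track D n x ≤ ∑ i, |x i| := fun n =>
    (DNormTrack.track D n).le_sum_abs
  have hlim : ∀ x : Fin d → ℝ, Tendsto (fun n : ℕ => DNormTrack.track D n x) atTop
      (𝓝 (⨆ n, DNormTrack.track D n x)) := fun x =>
    tendsto_atTop_ciSup (hmono x) ⟨∑ i, |x i|, by rintro _ ⟨n, rfl⟩; exact hle n x⟩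
  refine ⟨hmono, hle, fun x => ⨆ n, DNormTrack.track D n x, hlim, ?_⟩
  exact (DNormTrack.isCompact_setOf_isDNorm d).isClosed.mem_of_tendsto (tendsto_pi_nhds.2 hlim)
    (Eventually.of_forall fun n => (DNormTrack.track D n).isDNorm)
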